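/- Let $q=2^e$ be a power of $2$ and let $\mathbb F_q$ be a finite field with $q$ elements. Then every subgroup $S\leq \mathrm{SL}(2,q)=\mathrm{SL}(2,\mathbb F_q)$ of order $q+1$ is cyclic, and it is unique up to conjugation: for any two subgroups $S,S'\leq\mathrm{SL}(2,q)$ of order $q+1$ there is $h\in \mathrm{SL}(2,q)$ with $S'=hSh^{-1}$. -/

import Mathlib

/-! Only the oddness of q + 1 matters. For S of odd order in characteristic 2, averaging a trace-one
matrix over S gives a matrix Y of trace 1 commuting with S. Y is not scalar, so S lies in the
commutative algebra F[Y]; sending Y to an eigenvalue embeds S in the units of the algebraic closure,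
and S is cyclic. Two such groups of order n both map onto the n-th roots of unity, so they have
generators sharing an eigenvalue, hence a trace. Nontrivial elements of equal trace are conjugate
because every element of F is a square. -/

open Matrix in
/-- Averaging a matrix of trace one over a finite group of odd order, in characteristic two. -/
theorem exists_trace_one_commute_of_odd {F : Type*} [Field F] [CharP F 2]
    (S : Subgroup (Matrix.SpecialLinearGroup (Fin 2) F)) (hS : Odd (Nat.card S)) :
    ∃ Y : Matrix (Fin 2) (Fin 2) F, Y.trace = 1 ∧
      ∀ s ∈ S, (s : Matrix (Fin 2) (Fin 2) F) * Y = Y * s := by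
  have : Finite S := Nat.finite_of_card_ne_zero fun h => by simp [h] at hS
  have := Fintype.ofFinite S
  let X : Matrix (Fin 2) (Fin 2) F := !![1, 0; 0, 0]
  let c : S → Matrix (Fin 2) (Fin 2) F := fun g =>
    ((g : Matrix.SpecialLinearGroup (Fin 2) F) : Matrix (Fin 2) (Fin 2) F) * X *
      ((g⁻¹ : S) : Matrix.SpecialLinearGroup (Fin 2) F)
  have cancel (g : S) : (((g⁻¹ : S) : Matrix.SpecialLinearGroup (Fin 2) F) : Matrix (Fin 2) (Fin 2) F) *
      ((g : Matrix.SpecialLinearGroup (Fin 2) F) : Matrix (Fin 2) (Fin 2) F) = 1 := by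
    rw [← Matrix.SpecialLinearGroup.coe_mul, ← Subgroup.coe_mul, inv_mul_cancel, Subgroup.coe_one,
      Matrix.SpecialLinearGroup.coe_one]
  refine ⟨∑ g, c g, ?_, fun s hs => ?_⟩
  · have htr (g : S) : (c g).trace = 1 := by
      rw [trace_mul_comm, ← mul_assoc, cancel, one_mul]
      simp [X, trace_fin_two]
    rw [trace_sum, Finset.sum_congr rfl fun g _ => htr g, Finset.sum_const, Finset.card_univ,
      ← Nat.card_eq_fintype_card, nsmul_one]
    obtain ⟨k, hk⟩ := hS
    rw [hk]
    push_cast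
    linear_combination (k : F) * CharTwo.two_eq_zero (R := F)
  · rw [Finset.mul_sum, Finset.sum_mul]
    refine Fintype.sum_equiv (Equiv.mulLeft ⟨s, hs⟩) _ _ fun g => ?_
    have := cancel ⟨s, hs⟩
    simp only [c, Equiv.coe_mulLeft, _root_.mul_inv_rev, Subgroup.coe_mul, Matrix.SpecialLinearGroup.coe_mul,
      mul_assoc, this, mul_one]

open Matrix in
/-- An odd order subgroup of `SL₂` in characteristic two has a faithful character
with values in an algebraic closure, picking an eigenvalue of each element. -/
theorem exists_injective_eigenvalue_hom_of_odd {F : Type*} [Field F] [CharP F 2]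
    (S : Subgroup (Matrix.SpecialLinearGroup (Fin 2) F)) (hS : Odd (Nat.card S)) :
    ∃ χ : S →* AlgebraicClosure F, Function.Injective χ ∧
      ∀ s : S, χ s * (χ s + algebraMap F (AlgebraicClosure F)
        (s : Matrix.SpecialLinearGroup (Fin 2) F).1.trace) = 1 := by
  obtain ⟨Y, hY, hc⟩ := exists_trace_one_commute_of_odd S hS
  set K := AlgebraicClosure F
  have h2 : (2 : F) = 0 := CharTwo.two_eq_zero
  have h2K : (2 : K) = 0 := by rw [← map_ofNat (algebraMap F K) 2, h2, map_zero]
  obtain ⟨μ, hμ⟩ : ∃ μ : K, μ ^ 2 + μ + algebraMap F K Y.det = 0 := by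
    obtain ⟨μ, hμ⟩ := IsAlgClosed.exists_root
      (Polynomial.X ^ 2 + Polynomial.X + Polynomial.C (algebraMap F K Y.det))
      (by
        have : (Polynomial.X ^ 2 + Polynomial.X + Polynomial.C (algebraMap F K Y.det)).degree
            = 2 := by compute_degree!
        rw [this]; decide)
    exact ⟨μ, by simpa using hμ⟩
  rw [det_fin_two] at hμ
  rw [trace_fin_two] at hY
  have hY' : Y 1 1 = 1 - Y 0 0 := by linear_combination hY
  -- Commuting with the non-scalar Y forces s = a + bY; here b = tr s, since tr(a + bY) = 2a + b.
  have key (s : S) : ∃ a b : F, (s : Matrix.SpecialLinearGroup (Fin 2) F).1 0 0 = a + b * Y 0 0 ∧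
      (s : Matrix.SpecialLinearGroup (Fin 2) F).1 0 1 = b * Y 0 1 ∧
      (s : Matrix.SpecialLinearGroup (Fin 2) F).1 1 0 = b * Y 1 0 ∧
      (s : Matrix.SpecialLinearGroup (Fin 2) F).1 1 1 = a + b * Y 1 1 := by
    have h := hc s s.2
    have h01 := congrFun₂ h 0 1
    have h10 := congrFun₂ h 1 0
    simp only [mul_apply, Fin.sum_univ_two, hY'] at h01 h10
    set m := (s : Matrix.SpecialLinearGroup (Fin 2) F).1
    refine ⟨m 0 0 - (m 0 0 + m 1 1) * Y 0 0, m 0 0 + m 1 1, by ring, ?_, ?_, ?_⟩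
    · linear_combination h01 - h2 * (m 0 0 * Y 0 1 - m 0 1 * Y 0 0)
    · linear_combination -h10 + h2 * (m 1 0 * Y 0 0 - m 0 0 * Y 1 0)
    · rw [hY']
      linear_combination -h2 * (m 0 0 - (m 0 0 + m 1 1) * Y 0 0)
  choose a b h00 h01 h10 h11 using key
  have htr (s : S) : (s : Matrix.SpecialLinearGroup (Fin 2) F).1.trace = b s := by
    rw [trace_fin_two, h00, h11]
    linear_combination a s * h2 + b s * hY
  have hmul (s t : S) : b (s * t) = a s * b t + b s * a t + b s * b t ∧
      a (s * t) = a s * a t + b s * b t * (Y 0 0 * Y 1 1 - Y 0 1 * Y 1 0) := by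
    have e : ((s * t : S) : Matrix.SpecialLinearGroup (Fin 2) F).1 =
      (s : Matrix.SpecialLinearGroup (Fin 2) F).1 * (t : Matrix.SpecialLinearGroup (Fin 2) F).1 := rfl
    have e00 := congrFun₂ e 0 0
    have e11 := congrFun₂ e 1 1
    simp only [mul_apply, Fin.sum_univ_two, h00, h01, h10, h11, hY'] at e00 e11
    rw [hY']
    have hb : b (s * t) = a s * b t + b s * a t + b s * b t := by
      linear_combination e00 + e11 + h2 * (a s * a t - a (s * t)
        + b s * b t * (Y 0 0 ^ 2 - Y 0 0 + Y 0 1 * Y 1 0))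
    refine ⟨hb, ?_⟩
    linear_combination e00 - Y 0 0 * hb
      + h2 * (b s * b t * (Y 0 0 ^ 2 - Y 0 0 + Y 0 1 * Y 1 0))
  have hdet (s : S) : a s ^ 2 + a s * b s +
      b s ^ 2 * (Y 0 0 * Y 1 1 - Y 0 1 * Y 1 0) = 1 := by
    have e := (s : Matrix.SpecialLinearGroup (Fin 2) F).2
    rw [det_fin_two, h00, h01, h10, h11] at e
    linear_combination e - a s * b s * hY
  have hK (s : S) : (algebraMap F K (a s) + algebraMap F K (b s) * μ) *
      (algebraMap F K (a s) + algebraMap F K (b s) * μ + algebraMap F K (b s)) = 1 := by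
    have e := congrArg (algebraMap F K) (hdet s)
    simp only [map_add, map_mul, map_pow, map_one, map_sub] at e hμ
    linear_combination e + algebraMap F K (b s) ^ 2 * hμ
      + h2K * (algebraMap F K (a s) * algebraMap F K (b s) * μ - algebraMap F K (b s) ^ 2 *
        (algebraMap F K (Y 0 0) * algebraMap F K (Y 1 1)
          - algebraMap F K (Y 0 1) * algebraMap F K (Y 1 0)))
  have ext (s : S) (hb : b s = 0) (ha : a s = 1) : s = 1 := by
    apply Subtype.ext
    apply Matrix.SpecialLinearGroup.ext
    intro i j
    fin_cases i <;> fin_cases j <;> simp [h00, h01, h10, h11, ha, hb]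
  have one : b 1 = 0 ∧ a 1 = 1 := by
    have hb : b 1 = 0 := by
      rw [← htr]
      simp [h2]
    refine ⟨hb, ?_⟩
    have := h00 1
    simpa [hb] using this.symm
  -- Evaluation Y ↦ μ on F[Y], well defined since μ is a root of the characteristic polynomial of Y.
  let χ : S →* K :=
    { toFun := fun s => algebraMap F K (a s) + algebraMap F K (b s) * μ
      map_one' := by simp [one]
      map_mul' := fun s t => by
        obtain ⟨e1, e2⟩ := hmul s t
        rw [e1, e2]
        simp only [map_add, map_mul, map_sub] at hμ ⊢
        linear_combination -(algebraMap F K (b s) * algebraMap F K (b t)) * hμ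
          + h2K * (algebraMap F K (b s) * algebraMap F K (b t)) * (μ +
        (algebraMap F K (Y 0 0) * algebraMap F K (Y 1 1)
          - algebraMap F K (Y 0 1) * algebraMap F K (Y 1 0))) }
  refine ⟨χ, (injective_iff_map_eq_one χ).2 fun s hs => ?_, fun s => ?_⟩
  · have e := hK s
    have hs' : algebraMap F K (a s) + algebraMap F K (b s) * μ = 1 := hs
    rw [hs', one_mul, add_eq_left] at e
    rw [e, zero_mul, add_zero] at hs'
    exact ext s ((map_eq_zero _).1 e) ((algebraMap F K).injective (by rw [hs', map_one]))
  · rw [htr]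
    exact hK s

open Matrix in
/-- Over a field of characteristic two in which all elements are squares, a nontrivial element
of `SL₂` is conjugate to the companion matrix of its characteristic polynomial. -/
theorem exists_conj_companion_of_ne_one {F : Type*} [Field F] [CharP F 2]
    (hsq : ∀ x : F, IsSquare x) (A : Matrix.SpecialLinearGroup (Fin 2) F) (hA : A ≠ 1) :
    ∃ h : Matrix.SpecialLinearGroup (Fin 2) F,
      A.1 * h.1 = h.1 * !![0, 1; 1, A.1.trace] := by
  have h2 : (2 : F) = 0 := CharTwo.two_eq_zero
  have hd := A.2
  rw [det_fin_two] at hd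
  -- The form is det[w, Aw] for w = (u, v); if it vanished identically, A would be scalar.
  obtain ⟨u, v, huv⟩ : ∃ u v : F, A.1 1 0 * u ^ 2 + (A.1 1 1 - A.1 0 0) * u * v
      - A.1 0 1 * v ^ 2 ≠ 0 := by
    by_contra! H
    have e1 := H 1 0
    have e2 := H 0 1
    have e3 := H 1 1
    have z10 : A.1 1 0 = 0 := by linear_combination e1
    have z01 : A.1 0 1 = 0 := by linear_combination -e2
    have z11 : A.1 1 1 = A.1 0 0 := by linear_combination e3 - e1 - e2
    have z00 : A.1 0 0 = 1 := by
      rw [z10, z01, z11] at hd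
      have : (A.1 0 0 - 1) ^ 2 = 0 := by linear_combination hd + h2 * (1 - A.1 0 0)
      exact sub_eq_zero.1 (pow_eq_zero_iff two_ne_zero |>.1 this)
    apply hA
    apply Matrix.SpecialLinearGroup.ext
    intro i j
    fin_cases i <;> fin_cases j <;> simp [z00, z01, z10, z11]
  -- Scaling by c gives the basis cw, cAw determinant 1.
  obtain ⟨c, hc⟩ := hsq (A.1 1 0 * u ^ 2 + (A.1 1 1 - A.1 0 0) * u * v - A.1 0 1 * v ^ 2)⁻¹
  have hc1 : c * c *
      (A.1 1 0 * u ^ 2 + (A.1 1 1 - A.1 0 0) * u * v - A.1 0 1 * v ^ 2) = 1 := by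
    rw [← hc, inv_mul_cancel₀ huv]
  refine ⟨⟨!![c * u, c * (A.1 0 0 * u + A.1 0 1 * v); c * v, c * (A.1 1 0 * u + A.1 1 1 * v)],
    ?_⟩, ?_⟩
  · rw [det_fin_two_of]
    linear_combination hc1
  · ext i j
    fin_cases i <;> fin_cases j <;>
      simp [mul_apply, Fin.sum_univ_two, trace_fin_two]
    · ring
    · linear_combination -(c * u) * hd - c * u * h2
    · ring
    · linear_combination -(c * v) * hd - c * v * h2

open Matrix in
/-- In characteristic two, nontrivial elements of `SL₂` with the same trace are conjugate. -/
theorem isConj_of_trace_eq {F : Type*} [Field F] [CharP F 2]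
    (hsq : ∀ x : F, IsSquare x) {A B : Matrix.SpecialLinearGroup (Fin 2) F} (hA : A ≠ 1) (hB : B ≠ 1)
    (h : A.1.trace = B.1.trace) : IsConj A B := by
  obtain ⟨P, hP⟩ := exists_conj_companion_of_ne_one hsq A hA
  obtain ⟨Q, hQ⟩ := exists_conj_companion_of_ne_one hsq B hB
  let C : Matrix.SpecialLinearGroup (Fin 2) F := ⟨!![0, 1; 1, A.1.trace], by
    rw [det_fin_two_of]
    linear_combination -CharTwo.two_eq_zero (R := F)⟩
  have hP' : A * P = P * C := Subtype.ext hP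
  have hQ' : B * Q = Q * C := Subtype.ext (by rw [← h] at hQ; exact hQ)
  have hPc : IsConj C A := isConj_iff.2 ⟨P, by rw [← hP', mul_inv_cancel_right]⟩
  have hQc : IsConj C B := isConj_iff.2 ⟨Q, by rw [← hQ', mul_inv_cancel_right]⟩
  exact hPc.symm.trans hQc

open Matrix in
/-- Odd order subgroups of `SL₂` in characteristic two are cyclic. -/
theorem isCyclic_of_odd_card {F : Type*} [Field F] [CharP F 2]
    (S : Subgroup (Matrix.SpecialLinearGroup (Fin 2) F)) (hS : Odd (Nat.card S)) : IsCyclic S := by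
  have : Finite S := Nat.finite_of_card_ne_zero fun h => by simp [h] at hS
  obtain ⟨χ, hχ, -⟩ := exists_injective_eigenvalue_hom_of_odd S hS
  exact isCyclic_of_injective_ringHom χ hχ

open Matrix in
/-- Subgroups of `SL₂` of the same odd order in characteristic two are conjugate. -/
theorem exists_conj_of_odd_card_eq {F : Type*} [Field F] [CharP F 2]
    (hsq : ∀ x : F, IsSquare x) (S S' : Subgroup (Matrix.SpecialLinearGroup (Fin 2) F))
    (hS : Odd (Nat.card S)) (hSS' : Nat.card S' = Nat.card S) :
    ∃ h : Matrix.SpecialLinearGroup (Fin 2) F, S' = S.map (MulAut.conj h).toMonoidHom := by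
  have hS' : Odd (Nat.card S') := hSS' ▸ hS
  have : Finite S := Nat.finite_of_card_ne_zero fun h => by simp [h] at hS
  have : Finite S' := Nat.finite_of_card_ne_zero fun h => by simp [h] at hS'
  obtain ⟨χ, hχ, hχt⟩ := exists_injective_eigenvalue_hom_of_odd S hS
  obtain ⟨χ', hχ', hχt'⟩ := exists_injective_eigenvalue_hom_of_odd S' hS'
  obtain ⟨s, hs⟩ := (isCyclic_of_odd_card S hS).exists_ofOrder_eq_natCard
  obtain ⟨t, ht⟩ := (isCyclic_of_odd_card S' hS').exists_ofOrder_eq_natCard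
  have hprim : IsPrimitiveRoot (χ' t) (Nat.card S) := by
    rw [← hSS', ← ht, ← orderOf_injective χ' hχ' t]
    exact IsPrimitiveRoot.orderOf _
  have : NeZero (Nat.card S) := ⟨Nat.card_pos.ne'⟩
  obtain ⟨i, -, hi⟩ := hprim.eq_pow_of_pow_eq_one (ξ := χ s)
    (by rw [← map_pow, ← hs, pow_orderOf_eq_one, map_one])
  rw [← map_pow] at hi
  set r := t ^ i
  have hr : orderOf r = Nat.card S' := by
    rw [← orderOf_injective χ' hχ' r, hi, orderOf_injective χ hχ, hs, hSS']
  have htr : (s : Matrix.SpecialLinearGroup (Fin 2) F).1.trace =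
      (r : Matrix.SpecialLinearGroup (Fin 2) F).1.trace := by
    -- The relation χ(χ + tr) = 1 determines the trace from χ.
    have e := (hχt s).trans (hχt' r).symm
    rw [hi] at e
    have h0 : χ s ≠ 0 := left_ne_zero_of_mul_eq_one (hχt s)
    exact (algebraMap F (AlgebraicClosure F)).injective
      (add_left_cancel (mul_left_cancel₀ h0 e))
  have hconj : IsConj (s : Matrix.SpecialLinearGroup (Fin 2) F) r := by
    by_cases h1 : (s : Matrix.SpecialLinearGroup (Fin 2) F) = 1
    · have hs1 : s = 1 := Subtype.ext h1
      have hr1 : r = 1 := hχ' (by rw [hi, hs1, map_one, map_one])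
      rw [hs1, hr1]
      exact IsConj.refl _
    · refine isConj_of_trace_eq hsq h1 (fun h => h1 ?_) htr
      have hr1 : r = 1 := Subtype.ext h
      have hs1 : s = 1 := hχ (by rw [← hi, hr1, map_one, map_one])
      rw [hs1, Subgroup.coe_one]
  have gen (T : Subgroup (Matrix.SpecialLinearGroup (Fin 2) F)) [Finite T] (x : T)
      (hx : orderOf x = Nat.card T) : T = Subgroup.zpowers (x : Matrix.SpecialLinearGroup (Fin 2) F) := by
    refine (Subgroup.eq_of_le_of_card_ge (Subgroup.zpowers_le.2 x.2) ?_).symm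
    rw [Nat.card_zpowers, Subgroup.orderOf_coe, hx]
  obtain ⟨h, hh⟩ := isConj_iff.1 hconj
  refine ⟨h, ?_⟩
  rw [gen S s hs, gen S' r hr, MonoidHom.map_zpowers, ← hh]
  rfl

theorem mainTheorem5 (e : ℕ) (q : ℕ) (hq : q = 2 ^ e) (F : Type*) [Field F] [Finite F]
    (hF : Nat.card F = q) :
    (∀ S : Subgroup (Matrix.SpecialLinearGroup (Fin 2) F), Nat.card S = q + 1 → IsCyclic S) ∧
    (∀ S S' : Subgroup (Matrix.SpecialLinearGroup (Fin 2) F),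
      Nat.card S = q + 1 → Nat.card S' = q + 1 →
        ∃ h : Matrix.SpecialLinearGroup (Fin 2) F,
          S' = S.map (MulAut.conj h).toMonoidHom) := by
  have he : e ≠ 0 := by
    rintro rfl
    have := Finite.one_lt_card (α := F)
    simp [hF, hq] at this
  have hchar : CharP F 2 := by
    have := Fintype.ofFinite F
    have h0 : ((2 : ℕ) : F) ^ e = 0 := by
      rw [← Nat.cast_pow, ← hq, ← hF, Nat.card_eq_fintype_card, FiniteField.cast_card_eq_zero]
    exact CharTwo.of_one_ne_zero_of_two_eq_zero one_ne_zero (by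
      simpa using (pow_eq_zero_iff he).1 h0)
  have hodd : Odd (q + 1) := by
    rw [hq]
    exact (even_two.pow_of_ne_zero he).add_one
  have hsq (x : F) : IsSquare x :=
    FiniteField.isSquare_of_char_two ((ringChar.eq_iff).2 hchar) x
  exact ⟨fun S hS => isCyclic_of_odd_card S (hS ▸ hodd),
    fun S S' hS hS' => exists_conj_of_odd_card_eq hsq S S' (hS ▸ hodd) (hS'.trans hS.symm)⟩
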